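/- Let $\Theta$ be an open set of parameters (in a real normed space, e.g. $\mathbb R$ or $\mathbb R^m$) and let $\rho_\theta=\sum_{i=1}^d p_i(\theta)|w_i(\theta)\rangle\langle w_i(\theta)|$, $\theta\in\Theta$, be a family of $d$-dimensional quantum states given by a differentiable spectral decomposition (the $p_i(\theta)$ are a probability vector, the $w_i(\theta)$ an orthonormal basis of $\mathbb C^d$). For directions $u,v$ put $$C_\Upsilon(u,v)=\sum_{i}\frac1{p_i}\,\partial_up_i\,\partial_vp_i+4\,\mathrm{Re}\sum_{i<j}(p_i+p_j)\langle\partial_uw_i|w_j\rangle\langle w_j|\partial_vw_i\rangle+4\,\mathrm{Re}\sum_ip_i\langle\partial_uw_i|w_i\rangle\langle w_i|\partial_vw_i\rangle$$ (terms with $p_i=0$ are omitted from the first sum) and $$C_L(u,v)=C_\Upsilon(u,v)-4\,\mathrm{Re}\sum_ip_i\langle\partial_uw_i|w_i\rangle\langle w_i|\partial_vw_i\rangle .$$ For a one-parameter family, $C_L$ denotes the number $C_L(1,1)$. Call the decomposition regular at $\theta$ if $\langle\partial_uw_j|w_k\rangle=0$ for all $u$ whenever $j\ne k$ and $p_j=p_k\neq0$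 at $\theta$; this holds in particular whenever the nonzero eigenvalues of $\rho_\theta$ are pairwise distinct. A channel is a trace-preserving completely positive linear map between matrix algebras. Then: 1. $C_L(u,u)=\sum_i\frac1{p_i}(\partial_up_i)^2+4\sum_{j<k}(p_j+p_k)|\langle\partial_uw_j|w_k\rangle|^2$. 2. $C_L$ is a Riemannian metric: at each $\theta$ it is a symmetric positive semidefinite bilinear form, with $C_L(u,u)>0$ whenever $\partial_u\rho_\theta\ne0$; it depends smoothly on $\theta$ if the $p_i,w_i$ are smooth and each $p_i$ is either everywhere positive or identically zero on $\Theta$; and it transforms as a metric tensor under differentiable changes of parameter: for $\theta=\varphi(x)$ the reparametrized family has $C_L$ at $x$ in the directions $u,v$ equal to $C_L$ at $\varphi(x)$ in the directions $d\varphi_x(u),d\varphi_x(v)$. 3. At every $\theta$ where the decomposition is regular, $C_L$ has the Morozova–Chentsov form with constant $1$ and function $c_L(x,y)=\frac{2(x+y)}{(x-y)^2}$: with $A=\partial_u\rho_\theta$ and $A_{jk}=\langle w_j|A|w_k\rangle$, $$C_L(u,u)=\sum_i\frac1{p_i}|A_{ii}|^2+2\sum_{j<k}c_L(p_j,p_k)|A_{jk}|^2,$$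 where terms with $p_i=0$ in the first sum and with $p_j=p_k$ in the second are omitted. Moreover $c_L(x,y)=c_L(y,x)$ and $c_L(\alpha x,\alpha y)=\alpha^{-1}c_L(x,y)$ for $\alpha>0$. 4. $C_L$ is invariant: if two families $\rho_\theta,\sigma_\theta$ (possibly of different dimensions) over the same $\Theta$ satisfy $\rho_\theta=\mathcal E(\sigma_\theta)$ and $\sigma_\theta=\mathcal F(\rho_\theta)$ for all $\theta\in\Theta$ with fixed channels $\mathcal E,\mathcal F$, then their $C_L$ agree at every $\theta$ where both decompositions are regular. In particular, at such points $C_L$ depends only on the family of states, not on the chosen decomposition. 5. The function associated with $C_L$ is $f(t)=1/c_L(t,1)=\frac{(t-1)^2}{2(1+t)}$ ($t\ge0$, $t\neq1$). It satisfies $f(t)=t\,f(t^{-1})$ for $t>0$, but $f(0)>f(1)$, and it is not monotone on $[0,\infty)$, nor on $(0,\infty)$. 6. $C_L$ is not monotone: it is not true that $C_L(\mathcal E(\rho_\theta))\le C_L(\rho_\theta)$ for all channels $\mathcal E$, even for one-parameter families for which both $\rho_\theta$ and $\mathcal E(\rho_\theta)$ have full rank and pairwise distinct eigenvalues. 7.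 Explicitly, let $0\le\delta\le\frac12$, $|\eta|\le\delta$, $0\le\varepsilon\le1$, and let $\rho_\theta$ ($\theta\in\mathbb R$) have eigenvalues $1-2\delta,\ \delta+\eta,\ \delta-\eta$ and eigenvectors $w_1=(1,0,0)$, $w_2=(0,\cos\theta,\sin\theta)$, $w_3=(0,-\sin\theta,\cos\theta)$. The depolarizing map $\mathcal E(\rho)=(1-\varepsilon)\rho+\frac{\varepsilon}{3}I_3$ (for $\operatorname{tr}\rho=1$) is a channel, $\mathcal E(\rho_\theta)$ has the same eigenvectors with the eigenvalues $p_i$ replaced by $(1-\varepsilon)p_i+\frac\varepsilon3$, and, with $C_L$ computed from these decompositions, $$C_L(\rho_\theta)=8\delta,\qquad C_L(\mathcal E(\rho_\theta))=8\delta+8\varepsilon\left(\tfrac13-\delta\right),$$ so that $C_L$ changes by $8\varepsilon(\frac13-\delta)$; this is a strict increase if $\varepsilon>0$ and $\delta<\frac13$. -/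

import Mathlib

open scoped ContDiff ComplexOrder

noncomputable section

/-- The data of a parametric family of `d`-dimensional quantum states given through its spectral
decomposition `ρ_θ = ∑ i, p_i(θ) |w_i(θ)⟩⟨w_i(θ)|`; the parameter `θ` ranges over (a subset of)
the real normed space `E` (`E = ℝ`: one parameter, `E = ℝ^m`: `m` parameters). -/
structure SpectralFamily (E : Type*) (d : ℕ) where
  /-- eigenvalues -/
  p : E → Fin d → ℝ
  /-- eigenvectors -/
  w : E → Fin d → EuclideanSpace ℂ (Fin d)

namespace SpectralFamily

variable {E F : Type*} [NormedAddCommGroup E] [NormedSpace ℝ E]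
  [NormedAddCommGroup F] [NormedSpace ℝ F] {d : ℕ}

/-- The density matrix `ρ_θ = ∑ i, p_i(θ) |w_i(θ)⟩⟨w_i(θ)|`. -/
def state (D : SpectralFamily E d) (θ : E) : Matrix (Fin d) (Fin d) ℂ :=
  Matrix.of fun a b => ∑ i, (D.p θ i : ℂ) * (D.w θ i a * star (D.w θ i b))

/-- `D` is a differentiable spectral decomposition of a family of states over the open parameter
domain `Θ`: the `p_i(θ)` form a probability vector and the `w_i(θ)` an orthonormal basis. -/
structure IsModelOn (D : SpectralFamily E d) (Θ : Set E) : Prop where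
  isOpen : IsOpen Θ
  p_nonneg : ∀ θ ∈ Θ, ∀ i, 0 ≤ D.p θ i
  p_sum : ∀ θ ∈ Θ, ∑ i, D.p θ i = 1
  orthonormal : ∀ θ ∈ Θ, Orthonormal ℂ (D.w θ)
  differentiable_p : ∀ i, DifferentiableOn ℝ (fun θ => D.p θ i) Θ
  differentiable_w : ∀ i, DifferentiableOn ℝ (fun θ => D.w θ i) Θ

/-- A smooth spectral decomposition of constant rank: every eigenvalue is either positive on the
whole of `Θ` or identically zero on `Θ`. -/
structure IsSmoothModelOn (D : SpectralFamily E d) (Θ : Set E) : Prop extends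
    D.IsModelOn Θ where
  smooth_p : ∀ i, ContDiffOn ℝ ∞ (fun θ => D.p θ i) Θ
  smooth_w : ∀ i, ContDiffOn ℝ ∞ (fun θ => D.w θ i) Θ
  rank_const : ∀ i, (∀ θ ∈ Θ, 0 < D.p θ i) ∨ (∀ θ ∈ Θ, D.p θ i = 0)

/-- Derivative of the eigenvalue `p_i` in the direction `u`. -/
def dp (D : SpectralFamily E d) (θ u : E) (i : Fin d) : ℝ :=
  fderiv ℝ (fun t => D.p t i) θ u

/-- Derivative of the eigenvector `w_i` in the direction `u`. -/
def dw (D : SpectralFamily E d) (θ u : E) (i : Fin d) : EuclideanSpace ℂ (Fin d) :=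
  fderiv ℝ (fun t => D.w t i) θ u

/-- The tangent vector `A = dρ_θ(u)`, the (entrywise) derivative of `ρ_θ` in the direction `u`. -/
def tangent (D : SpectralFamily E d) (θ u : E) : Matrix (Fin d) (Fin d) ℂ :=
  Matrix.of fun a b => fderiv ℝ (fun t => D.state t a b) θ u

/-- The Sarovar–Milburn quantum information
`∑ (1/p_i) ∂_u p_i ∂_v p_i + 4 Re ∑_{i<j} (p_i + p_j) ⟨∂_u w_i|w_j⟩⟨w_j|∂_v w_i⟩
  + 4 Re ∑ p_i ⟨∂_u w_i|w_i⟩⟨w_i|∂_v w_i⟩`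
of a family given by its spectral decomposition, as a form in the directions `u, v`; for
coordinates `θ^1, …, θ^m` the matrix entry `(k, l)` is the value at the basis vectors `e_k, e_l`.
Terms with `p_i = 0` in the first sum are omitted (`0⁻¹ = 0`). -/
def CUpsilon (D : SpectralFamily E d) (θ u v : E) : ℝ :=
  ∑ i, (D.p θ i)⁻¹ * D.dp θ u i * D.dp θ v i
  + 4 * ∑ i, ∑ j ∈ Finset.Ioi i, (D.p θ i + D.p θ j) *
      (inner ℂ (D.dw θ u i) (D.w θ j) * inner ℂ (D.w θ j) (D.dw θ v i)).re
  + 4 * ∑ i, D.p θ i * (inner ℂ (D.dw θ u i) (D.w θ i) * inner ℂ (D.w θ i) (D.dw θ v i)).re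

/-- The `C_L` quantum information
`C_L = C_Υ - 4 Re ∑ p_i ⟨∂_u w_i|w_i⟩⟨w_i|∂_v w_i⟩`. For a one-parameter family (`E = ℝ`) the
scalar quantity is the value at `u = v = 1`. -/
def CL (D : SpectralFamily E d) (θ u v : E) : ℝ :=
  D.CUpsilon θ u v
  - 4 * ∑ i, D.p θ i * (inner ℂ (D.dw θ u i) (D.w θ i) * inner ℂ (D.w θ i) (D.dw θ v i)).re

/-- Reparametrization of a family by `θ = φ(x)`. -/
def comp (D : SpectralFamily E d) (φ : F → E) : SpectralFamily F d where
  p x := D.p (φ x)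
  w x := D.w (φ x)

/-- At `θ` the frame `w` does not rotate inside an eigenspace belonging to a repeated nonzero
eigenvalue. This holds trivially when the nonzero eigenvalues at `θ` are pairwise distinct. -/
def IsRegularAt (D : SpectralFamily E d) (θ : E) : Prop :=
  ∀ j k, j ≠ k → D.p θ j = D.p θ k → D.p θ j ≠ 0 → ∀ u, inner ℂ (D.dw θ u j) (D.w θ k) = 0

/-- `ρ_θ` has full rank and pairwise distinct eigenvalues. -/
def IsSimpleAt (D : SpectralFamily E d) (θ : E) : Prop :=
  (∀ i, 0 < D.p θ i) ∧ Function.Injective (D.p θ)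

end SpectralFamily

/-- The Morozova–Chentsov function of `C_L`. -/
def cL (x y : ℝ) : ℝ := 2 * ((x + y) / (x - y) ^ 2)

/-- The function `f` associated with `C_L`. -/
def fCL (t : ℝ) : ℝ := (t - 1) ^ 2 / (2 * (1 + t))

/-- The matrix element `⟨x|A|y⟩`. -/
def braket {d : ℕ} (x : EuclideanSpace ℂ (Fin d)) (A : Matrix (Fin d) (Fin d) ℂ)
    (y : EuclideanSpace ℂ (Fin d)) : ℂ :=
  ∑ a, ∑ b, star (x a) * A a b * y b

/-- The Morozova–Chentsov form of the squared length of the tangent vector `A` at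
`ρ = ∑ j, p_j |w_j⟩⟨w_j|`:
`C ∑ i, |A_ii|² / p_i + 2 ∑_{j<k} c(p_j, p_k) |A_jk|²` with `A_jk = ⟨w_j|A|w_k⟩`. -/
def morozovaChentsovForm (C : ℝ) (c : ℝ → ℝ → ℝ) {d : ℕ} (p : Fin d → ℝ)
    (w : Fin d → EuclideanSpace ℂ (Fin d)) (A : Matrix (Fin d) (Fin d) ℂ) : ℝ :=
  C * ∑ i, (p i)⁻¹ * ‖braket (w i) A (w i)‖ ^ 2
  + 2 * ∑ j, ∑ k ∈ Finset.Ioi j, c (p j) (p k) * ‖braket (w j) A (w k)‖ ^ 2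

/-- The ampliation `I_k ⊗ Φ` of a linear map between matrix algebras. -/
def ampliation {n m : ℕ} (k : ℕ)
    (Φ : Matrix (Fin n) (Fin n) ℂ →ₗ[ℂ] Matrix (Fin m) (Fin m) ℂ)
    (B : Matrix (Fin k × Fin n) (Fin k × Fin n) ℂ) :
    Matrix (Fin k × Fin m) (Fin k × Fin m) ℂ :=
  Matrix.of fun x y => Φ (Matrix.of fun i j => B (x.1, i) (y.1, j)) x.2 y.2

/-- Quantum channels: trace-preserving completely positive linear maps. -/
structure IsChannel {n m : ℕ}
    (Φ : Matrix (Fin n) (Fin n) ℂ →ₗ[ℂ] Matrix (Fin m) (Fin m) ℂ) : Prop where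
  trace_preserving : ∀ A, (Φ A).trace = A.trace
  completely_positive : ∀ (k : ℕ) (B : Matrix (Fin k × Fin n) (Fin k × Fin n) ℂ),
    B.PosSemidef → (ampliation k Φ B).PosSemidef

/-- Equivalence of two families of states over `Θ`: fixed channels, independent of `θ`, map each
of them to the other. -/
def EquivalentOn {E : Type*} {n m : ℕ} (Θ : Set E) (D : SpectralFamily E n)
    (D' : SpectralFamily E m) : Prop :=
  ∃ (Φ : Matrix (Fin m) (Fin m) ℂ →ₗ[ℂ] Matrix (Fin n) (Fin n) ℂ)
    (Ψ : Matrix (Fin n) (Fin n) ℂ →ₗ[ℂ] Matrix (Fin m) (Fin m) ℂ),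
    IsChannel Φ ∧ IsChannel Ψ ∧
      ∀ θ ∈ Θ, D.state θ = Φ (D'.state θ) ∧ D'.state θ = Ψ (D.state θ)

/-- Invariance of a quantum information quantity `J` where the families satisfy `P`:
equivalent families have the same `J`. -/
def IsInvariantWhere {E : Type*} [NormedAddCommGroup E] [NormedSpace ℝ E]
    (P : ∀ {d : ℕ}, SpectralFamily E d → E → Prop)
    (J : ∀ {d : ℕ}, SpectralFamily E d → E → E → E → ℝ) : Prop :=
  ∀ (n m : ℕ) (Θ : Set E) (D : SpectralFamily E n) (D' : SpectralFamily E m),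
    D.IsModelOn Θ → D'.IsModelOn Θ → EquivalentOn Θ D D' →
      ∀ θ ∈ Θ, P D θ → P D' θ → ∀ u v, J D θ u v = J D' θ u v

/-- Monotonicity of a quantum information quantity `J` where the families satisfy `P`:
`J(Φ(ρ_θ)) ≤ J(ρ_θ)` (as quadratic forms) for every channel `Φ`. -/
def IsMonotoneWhere {E : Type*} [NormedAddCommGroup E] [NormedSpace ℝ E]
    (P : ∀ {d : ℕ}, SpectralFamily E d → E → Prop)
    (J : ∀ {d : ℕ}, SpectralFamily E d → E → E → E → ℝ) : Prop :=
  ∀ (n m : ℕ) (Θ : Set E) (D : SpectralFamily E n) (D' : SpectralFamily E m)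
    (Φ : Matrix (Fin n) (Fin n) ℂ →ₗ[ℂ] Matrix (Fin m) (Fin m) ℂ),
    D.IsModelOn Θ → D'.IsModelOn Θ → IsChannel Φ → (∀ θ ∈ Θ, D'.state θ = Φ (D.state θ)) →
      ∀ θ ∈ Θ, P D θ → P D' θ → ∀ u, J D' θ u u ≤ J D θ u u

/-- The `d`-dimensional depolarizing channel `ρ ↦ (1 - ε) ρ + (ε/d) I` (extended linearly from
trace-one matrices). -/
def depolarizing (d : ℕ) (ε : ℝ) : Matrix (Fin d) (Fin d) ℂ →ₗ[ℂ] Matrix (Fin d) (Fin d) ℂ :=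
  ((1 - ε : ℝ) : ℂ) • LinearMap.id
  + ((ε / d : ℝ) : ℂ) • (Matrix.traceLinearMap (Fin d) ℂ ℂ).smulRight 1

/-- The frame `w₁ = (1,0,0)`, `w₂ = (0, cos θ, sin θ)`, `w₃ = (0, -sin θ, cos θ)`. -/
def rotatingFrame (θ : ℝ) : Fin 3 → EuclideanSpace ℂ (Fin 3) :=
  ![!₂[1, 0, 0], !₂[0, (Real.cos θ : ℂ), (Real.sin θ : ℂ)],
    !₂[0, (-Real.sin θ : ℂ), (Real.cos θ : ℂ)]]

/-- The one-parameter family with fixed eigenvalues `1 - 2δ, δ + η, δ - η` and eigenvectors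
`rotatingFrame θ`. -/
def inputFamily (δ η : ℝ) : SpectralFamily ℝ 3 where
  p _ := ![1 - 2 * δ, δ + η, δ - η]
  w := rotatingFrame

/-- The same frame with eigenvalues `(1 - ε) p_i + ε/3`. -/
def outputFamily (δ η ε : ℝ) : SpectralFamily ℝ 3 where
  p _ := ![(1 - ε) * (1 - 2 * δ) + ε / 3, (1 - ε) * (δ + η) + ε / 3, (1 - ε) * (δ - η) + ε / 3]
  w := rotatingFrame

end

noncomputable section

/-! The metric properties rest on one computation: in the eigenbasis the tangent vector `A` has
diagonal entries `∂p_j` and off-diagonal entries `(p_j - p_k)⟨∂w_j|w_k⟩` (`braket_tangent`).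
Substituting this gives the Morozova–Chentsov form.

Invariance is the hard part, because `C_L` is not monotone and cannot be compared directly along the
two channels. It is recovered from quantities that are monotone: for `α, β > 0` the sum of `|A_jk|²
/ (α p_j + β p_k)` over all `j, k` is the maximum over `X` of `2 Re Tr(Xᴴ A) - α Tr(Xᴴ ρ X) - β Tr(X
ρ Xᴴ)`. Pulling `X` back along the dual of a channel and using the Kadison–Schwarz inequality shows
that it decreases (`weightedNorm_le`), so equivalent families share all these values.

With `α = t + 1`, `β = t - 1` the sum becomes `∑ a_jk / (t + z_jk)`, where `a_jk = |A_jk|² / (p_j +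
p_k)` and `z_jk = (p_j - p_k) / (p_j + p_k)`. Uniqueness of partial fractions then determines the
total mass `a` at each value of `z`, hence `∑ a_jk H(z_jk)` for every function `H`, continuous or
not. At regular points `C_L` is such a sum, with `H = ratioWeight`.

Monotonicity fails because, for a fixed rotation of two eigenvectors, `C_L` is proportional to the
sum of their eigenvalues, which mixing with the identity can increase. -/

/-! ### Uniqueness of partial fractions -/

theorem sum_div_linear_eq_zero {ι : Type*} [Fintype ι] (a z : ι → ℝ) (hz : ∀ i, -1 ≤ z i)
    (h : ∀ t : ℝ, 1 < t → ∑ i, a i / (t + z i) = 0) (H : ℝ → ℝ) :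
    ∑ i, a i * H (z i) = 0 := by
  classical
  set Z := Finset.univ.image z with hZ
  set W : ℝ → ℝ := fun y => ∑ i with z i = y, a i with hW
  have fib : ∀ G : ℝ → ℝ, ∑ i, a i * G (z i) = ∑ y ∈ Z, W y * G y := by
    intro G
    rw [← Finset.sum_fiberwise_of_maps_to (t := Z) (g := z)
      (fun i _ => Finset.mem_image_of_mem z (Finset.mem_univ i))]
    refine Finset.sum_congr rfl fun y _ => ?_
    rw [hW, Finset.sum_mul]
    refine Finset.sum_congr rfl fun i hi => ?_
    rw [(Finset.mem_filter.1 hi).2]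
  have hZ1 : ∀ y ∈ Z, -1 ≤ y := by
    intro y hy
    obtain ⟨i, -, rfl⟩ := Finset.mem_image.1 hy
    exact hz i
  -- The numerator after grouping equal poles and clearing denominators; it vanishes at all `t > 1`,
  -- hence identically.
  let P : Polynomial ℝ := ∑ y ∈ Z, Polynomial.C (W y) *
    ∏ x ∈ Z.erase y, (Polynomial.X + Polynomial.C x)
  have evalP : ∀ t, P.eval t = ∑ y ∈ Z, W y * ∏ x ∈ Z.erase y, (t + x) := by
    intro t
    simp [P, Polynomial.eval_finsetSum, Polynomial.eval_prod]
  have hP : P = 0 := by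
    refine Polynomial.eq_zero_of_infinite_isRoot _ ((Set.Ioi_infinite (1 : ℝ)).mono ?_)
    intro t ht
    have ht : 1 < t := ht
    have h0 := h t ht
    simp only [div_eq_mul_inv] at h0
    rw [fib fun y => (t + y)⁻¹] at h0
    change P.eval t = 0
    rw [evalP]
    have : ∑ y ∈ Z, W y * ∏ x ∈ Z.erase y, (t + x)
        = (∑ y ∈ Z, W y * (t + y)⁻¹) * ∏ x ∈ Z, (t + x) := by
      rw [Finset.sum_mul]
      refine Finset.sum_congr rfl fun y hy => ?_
      have : t + y ≠ 0 := by have := hZ1 y hy; linarith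
      rw [← Finset.mul_prod_erase Z _ hy]
      field_simp
    rw [this, h0, zero_mul]
  rw [fib]
  refine Finset.sum_eq_zero fun y hy => ?_
  -- At `-y` every summand except that of `y` has a zero factor, so `W y` is isolated.
  have h1 := evalP (-y)
  rw [hP, Polynomial.eval_zero, Finset.sum_eq_single_of_mem y hy] at h1
  · have : ∏ x ∈ Z.erase y, (-y + x) ≠ 0 := by
      refine Finset.prod_ne_zero_iff.2 fun x hx => ?_
      intro hxy
      exact (Finset.mem_erase.1 hx).1 (by linarith)
    rw [(mul_eq_zero.1 h1.symm).resolve_right this, zero_mul]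
  · intro x _ hxy
    rw [Finset.prod_eq_zero (Finset.mem_erase.2 ⟨hxy.symm, hy⟩) (by ring), mul_zero]

theorem sum_mul_eq_of_sum_div_linear_eq {ι κ : Type*} [Fintype ι] [Fintype κ] (a z : ι → ℝ)
    (b y : κ → ℝ) (hz : ∀ i, -1 ≤ z i) (hy : ∀ i, -1 ≤ y i)
    (h : ∀ t : ℝ, 1 < t → ∑ i, a i / (t + z i) = ∑ i, b i / (t + y i)) (H : ℝ → ℝ) :
    ∑ i, a i * H (z i) = ∑ i, b i * H (y i) := by
  have := sum_div_linear_eq_zero (Sum.elim a fun i => -b i) (Sum.elim z y)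
    (by rintro (i | i) <;> simp [hz, hy])
    (by intro t ht; simp [h t ht, neg_div]) H
  simp only [Fintype.sum_sum_type, Sum.elim_inl, Sum.elim_inr, neg_mul,
    Finset.sum_neg_distrib] at this
  linarith

/-! ### Duality and the Schwarz inequality for channels -/

namespace IsChannel
open Matrix

variable {n m : ℕ} {Φ : Matrix (Fin n) (Fin n) ℂ →ₗ[ℂ] Matrix (Fin m) (Fin m) ℂ}

/-- Two-positivity on the block matrix `[[σ, σ Y], [Yᴴ σ, Yᴴ σ Y]]`. -/
theorem posSemidef_block (hΦ : IsChannel Φ) {σ : Matrix (Fin n) (Fin n) ℂ} (hσ : σ.PosSemidef)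
    (Y : Matrix (Fin n) (Fin n) ℂ) :
    (fromBlocks (Φ σ) (Φ (σ * Y)) (Φ (Yᴴ * σ)) (Φ (Yᴴ * σ * Y))).PosSemidef := by
  -- The block row `[1, Y]`, so that `Vᴴ σ V` is the required block matrix.
  let V : Matrix (Fin n) (Fin 2 × Fin n) ℂ :=
    of fun a x => if x.1 = 0 then (1 : Matrix _ _ ℂ) a x.2 else Y a x.2
  have hB := hΦ.completely_positive 2 _ (hσ.conjTranspose_mul_mul_same V)
  have key := hB.submatrix (Sum.elim (fun i : Fin m => ((0 : Fin 2), i)) fun i => ((1 : Fin 2), i))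
  have hV : ∀ x y : Fin 2, (of fun i j => (Vᴴ * σ * V) (x, i) (y, j)) =
      (if x = 0 then 1 else Y)ᴴ * σ * (if y = 0 then 1 else Y) := by
    have hV' : ∀ x : Fin 2, (of fun a i => V a (x, i)) = if x = 0 then 1 else Y := by
      intro x
      ext a i
      by_cases hx : x = 0 <;> simp [V, hx]
    intro x y
    rw [← hV', ← hV']
    ext i j
    simp [mul_apply]
  convert key using 1
  ext i j
  rcases i with i | i <;> rcases j with j | j <;> simp [ampliation, hV, submatrix]

/-- For `σ = 1` the off-diagonal blocks of the positive block matrix are `Φ Y` and `Φ Yᴴ`, and that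
matrix is Hermitian. -/
theorem map_conjTranspose (hΦ : IsChannel Φ) (Y : Matrix (Fin n) (Fin n) ℂ) :
    Φ Yᴴ = (Φ Y)ᴴ := by
  have h := (hΦ.posSemidef_block PosSemidef.one Y).isHermitian
  have := congrArg toBlocks₂₁ h.eq
  simpa [fromBlocks_conjTranspose] using this.symm

/-- The dual of a channel with respect to the Hilbert–Schmidt inner product. -/
theorem exists_adjoint (X : Matrix (Fin m) (Fin m) ℂ)
    (Φ : Matrix (Fin n) (Fin n) ℂ →ₗ[ℂ] Matrix (Fin m) (Fin m) ℂ) :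
    ∃ Y : Matrix (Fin n) (Fin n) ℂ, ∀ A, (Yᴴ * A).trace = (Xᴴ * Φ A).trace := by
  refine ⟨of fun a b => star (Xᴴ * Φ (single a b 1)).trace, fun A => ?_⟩
  conv_rhs => rw [matrix_eq_sum_single A]
  simp only [map_sum, Matrix.mul_sum, trace_sum]
  rw [trace, Finset.sum_comm]
  refine Finset.sum_congr rfl fun i _ => ?_
  simp only [diag_apply, mul_apply, conjTranspose_apply, of_apply, star_star]
  refine Finset.sum_congr rfl fun j _ => ?_
  have : single j i (A j i) = A j i • single j i (1 : ℂ) := by simp [smul_single]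
  rw [this, map_smul, Matrix.mul_smul, trace_smul, smul_eq_mul, mul_comm]

/-- Kadison–Schwarz inequality, paired with a positive matrix. -/
theorem schwarz (hΦ : IsChannel Φ) {σ : Matrix (Fin n) (Fin n) ℂ} (hσ : σ.PosSemidef)
    {X : Matrix (Fin m) (Fin m) ℂ} {Y : Matrix (Fin n) (Fin n) ℂ}
    (hXY : ∀ A, (Yᴴ * A).trace = (Xᴴ * Φ A).trace) :
    (Yᴴ * σ * Y).trace ≤ (Xᴴ * Φ σ * X).trace := by
  -- Compressing by the column `(X, 1)` gives four traces. By duality and trace preservation the two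
  -- cross terms and the last term all have absolute value `Tr(Yᴴ σ Y)`, with signs `-`, `-`, `+`.
  have h := hΦ.posSemidef_block hσ (-Y)
  have h2 := (h.conjTranspose_mul_mul_same (fromRows X 1)).trace_nonneg
  have e1 : (Xᴴ * Φ (σ * Y)).trace = (Yᴴ * σ * Y).trace := by
    rw [← hXY, Matrix.mul_assoc]
  have e2 : (Φ (Yᴴ * σ) * X).trace = (Yᴴ * σ * Y).trace := by
    have : Yᴴ * σ = (σ * Y)ᴴ := by rw [conjTranspose_mul, hσ.isHermitian.eq]
    rw [this, hΦ.map_conjTranspose]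
    have h3 := congrArg star e1
    rw [← trace_conjTranspose, ← trace_conjTranspose] at h3
    simp only [conjTranspose_mul, conjTranspose_conjTranspose, hσ.isHermitian.eq] at h3 ⊢
    rw [h3]
    simp [Matrix.mul_assoc]
  have e3 : (Φ (Yᴴ * σ * Y)).trace = (Yᴴ * σ * Y).trace := hΦ.trace_preserving _
  rw [conjTranspose_fromRows_eq_fromCols_conjTranspose, fromCols_mul_fromBlocks,
    fromCols_mul_fromRows] at h2
  simp only [conjTranspose_neg, Matrix.mul_neg, Matrix.neg_mul, neg_neg, map_neg,
    conjTranspose_one, Matrix.one_mul, Matrix.mul_one, Matrix.add_mul, trace_add, trace_neg,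
    e1, e2, e3] at h2
  rw [← sub_nonneg]
  convert h2 using 1
  ring

end IsChannel

/-! ### `C_L` as a form in the directions -/

namespace SpectralFamily

variable {E F : Type*} [NormedAddCommGroup E] [NormedSpace ℝ E]
  [NormedAddCommGroup F] [NormedSpace ℝ F] {d : ℕ}

theorem CL_eq (D : SpectralFamily E d) (θ u v : E) :
    D.CL θ u v = ∑ i, (D.p θ i)⁻¹ * D.dp θ u i * D.dp θ v i
      + 4 * ∑ i, ∑ j ∈ Finset.Ioi i, (D.p θ i + D.p θ j) *
        (inner ℂ (D.dw θ u i) (D.w θ j) * inner ℂ (D.w θ j) (D.dw θ v i)).re := by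
  rw [CL, CUpsilon, add_sub_cancel_right]

theorem CL_self (D : SpectralFamily E d) (θ u : E) :
    D.CL θ u u = ∑ i, (D.p θ i)⁻¹ * D.dp θ u i ^ 2
      + 4 * ∑ j, ∑ k ∈ Finset.Ioi j,
          (D.p θ j + D.p θ k) * ‖inner ℂ (D.dw θ u j) (D.w θ k)‖ ^ 2 := by
  rw [CL_eq]
  congr 1
  · exact Finset.sum_congr rfl fun i _ => by ring
  · congr 1
    refine Finset.sum_congr rfl fun i _ => Finset.sum_congr rfl fun j _ => ?_
    rw [← inner_conj_symm (D.w θ j), Complex.mul_conj', ← Complex.ofReal_pow, Complex.ofReal_re]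

theorem CL_symm (D : SpectralFamily E d) (θ u v : E) : D.CL θ u v = D.CL θ v u := by
  rw [CL_eq, CL_eq]
  congr 1
  · exact Finset.sum_congr rfl fun i _ => by ring
  · congr 1
    refine Finset.sum_congr rfl fun i _ => Finset.sum_congr rfl fun j _ => ?_
    rw [← inner_conj_symm (D.w θ j), ← inner_conj_symm (D.dw θ u i), ← map_mul,
      Complex.conj_re, mul_comm (inner ℂ (D.w θ j) _)]

theorem CL_smul_add (D : SpectralFamily E d) (θ : E) (a : ℝ) (u v v' : E) :
    D.CL θ u (a • v + v') = a * D.CL θ u v + D.CL θ u v' := by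
  have hw : ∀ i, D.dw θ (a • v + v') i = (a : ℂ) • D.dw θ v i + D.dw θ v' i := by
    intro i
    simp [dw]
  have hp : ∀ i, D.dp θ (a • v + v') i = a * D.dp θ v i + D.dp θ v' i := by
    intro i
    simp [dp]
  simp only [CL_eq, hw, hp, inner_add_right, inner_smul_right]
  have h1 : ∑ i, (D.p θ i)⁻¹ * D.dp θ u i * (a * D.dp θ v i + D.dp θ v' i) =
      a * ∑ i, (D.p θ i)⁻¹ * D.dp θ u i * D.dp θ v i +
        ∑ i, (D.p θ i)⁻¹ * D.dp θ u i * D.dp θ v' i := by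
    rw [Finset.mul_sum, ← Finset.sum_add_distrib]
    exact Finset.sum_congr rfl fun i _ => by ring
  have h2 : ∀ i j, (D.p θ i + D.p θ j) * (inner ℂ (D.dw θ u i) (D.w θ j) *
      (a * inner ℂ (D.w θ j) (D.dw θ v i) + inner ℂ (D.w θ j) (D.dw θ v' i))).re =
      a * ((D.p θ i + D.p θ j) *
        (inner ℂ (D.dw θ u i) (D.w θ j) * inner ℂ (D.w θ j) (D.dw θ v i)).re) +
      (D.p θ i + D.p θ j) *
        (inner ℂ (D.dw θ u i) (D.w θ j) * inner ℂ (D.w θ j) (D.dw θ v' i)).re := by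
    intro i j
    rw [mul_add, mul_left_comm _ (a : ℂ), Complex.add_re, Complex.re_ofReal_mul]
    ring
  simp only [h1, h2, Finset.sum_add_distrib, ← Finset.mul_sum]
  ring

/-- Reduces invariance of the bilinear form to that of the quadratic form. -/
theorem CL_polarization (D : SpectralFamily E d) (θ u v : E) :
    D.CL θ u v = (D.CL θ (u + v) (u + v) - D.CL θ u u - D.CL θ v v) / 2 := by
  have h : ∀ x y z, D.CL θ x (y + z) = D.CL θ x y + D.CL θ x z := by
    intro x y z
    simpa using D.CL_smul_add θ 1 x y z
  rw [h, D.CL_symm θ (u + v) u, D.CL_symm θ (u + v) v, h, h, D.CL_symm θ v u]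
  ring

/-! ### Differentiating the spectral decomposition -/

namespace IsModelOn

variable {D : SpectralFamily E d} {Θ : Set E} {θ : E}

theorem hasFDerivAt_p (hD : D.IsModelOn Θ) (hθ : θ ∈ Θ) (i : Fin d) :
    HasFDerivAt (fun t => D.p t i) (fderiv ℝ (fun t => D.p t i) θ) θ :=
  ((hD.differentiable_p i).differentiableAt (hD.isOpen.mem_nhds hθ)).hasFDerivAt

theorem hasFDerivAt_w (hD : D.IsModelOn Θ) (hθ : θ ∈ Θ) (i : Fin d) :
    HasFDerivAt (fun t => D.w t i) (fderiv ℝ (fun t => D.w t i) θ) θ :=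
  ((hD.differentiable_w i).differentiableAt (hD.isOpen.mem_nhds hθ)).hasFDerivAt

/-- The Gram matrix of the frame is locally constant, so its derivative vanishes. -/
theorem inner_w_dw (hD : D.IsModelOn Θ) (hθ : θ ∈ Θ) (u : E) (i j : Fin d) :
    inner ℂ (D.w θ i) (D.dw θ u j) = -inner ℂ (D.dw θ u i) (D.w θ j) := by
  have h1 := (hD.hasFDerivAt_w hθ i).inner ℂ (hD.hasFDerivAt_w hθ j)
  have h2 : (fun t => inner ℂ (D.w t i) (D.w t j)) =ᶠ[nhds θ] fun _ => if i = j then (1 : ℂ) else 0 := by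
    filter_upwards [hD.isOpen.mem_nhds hθ] with t ht
    exact orthonormal_iff_ite.1 (hD.orthonormal t ht) i j
  have h3 := h1.unique ((hasFDerivAt_const _ θ).congr_of_eventuallyEq h2)
  have h4 := congrArg (fun f => f u) h3
  simp [fderivInnerCLM_apply] at h4
  exact eq_neg_of_add_eq_zero_left h4

/-- A zero of a nonnegative function on an open set is a local minimum. This makes the omission of
terms with `p_i = 0` harmless. -/
theorem dp_eq_zero (hD : D.IsModelOn Θ) (hθ : θ ∈ Θ) (u : E) {i : Fin d} (hi : D.p θ i = 0) :
    D.dp θ u i = 0 := by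
  have : IsLocalMin (fun t => D.p t i) θ := by
    filter_upwards [hD.isOpen.mem_nhds hθ] with t ht
    rw [hi]
    exact hD.p_nonneg t ht i
  rw [dp, this.fderiv_eq_zero]
  rfl

theorem hasFDerivAt_state (hD : D.IsModelOn Θ) (hθ : θ ∈ Θ) (a b : Fin d) :
    ∃ L : E →L[ℝ] ℂ, HasFDerivAt (fun t => D.state t a b) L θ ∧ ∀ u, L u =
      ∑ i, (D.w θ i a * D.dp θ u i * star (D.w θ i b) +
        D.dw θ u i a * D.p θ i * star (D.w θ i b) +
        D.w θ i a * D.p θ i * star (D.dw θ u i b)) := by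
  have hp : ∀ i, HasFDerivAt (fun t => (D.p t i : ℂ))
      (Complex.ofRealCLM ∘L fderiv ℝ (fun t => D.p t i) θ) θ := fun i =>
    Complex.ofRealCLM.hasFDerivAt.comp θ (hD.hasFDerivAt_p hθ i)
  have hw : ∀ i c, HasFDerivAt (fun t => D.w t i c)
      (((EuclideanSpace.proj c : EuclideanSpace ℂ (Fin d) →L[ℂ] ℂ).restrictScalars ℝ) ∘L
        fderiv ℝ (fun t => D.w t i) θ) θ := fun i c =>
    (((EuclideanSpace.proj c : EuclideanSpace ℂ (Fin d) →L[ℂ] ℂ).restrictScalars ℝ).hasFDerivAt.comp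
      θ (hD.hasFDerivAt_w hθ i))
  have hs : HasFDerivAt (fun t => D.state t a b) _ θ := HasFDerivAt.fun_sum (u := Finset.univ)
    fun i _ => (hp i).mul ((hw i a).mul (hw i b).star)
  refine ⟨_, hs, fun u => ?_⟩
  simp only [_root_.sum_apply]
  refine Finset.sum_congr rfl fun i _ => ?_
  simp [dp, dw]
  ring

end IsModelOn

/-- The matrix whose columns are the eigenvectors. -/
def frame (D : SpectralFamily E d) (θ : E) : Matrix (Fin d) (Fin d) ℂ :=
  Matrix.of fun a i => D.w θ i a

/-- The matrix whose columns are the derivatives of the eigenvectors. -/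
def dframe (D : SpectralFamily E d) (θ u : E) : Matrix (Fin d) (Fin d) ℂ :=
  Matrix.of fun a i => D.dw θ u i a

open Matrix

omit [NormedAddCommGroup E] [NormedSpace ℝ E] in
theorem state_eq (D : SpectralFamily E d) (θ : E) :
    D.state θ = D.frame θ * diagonal (fun i => (D.p θ i : ℂ)) * (D.frame θ)ᴴ := by
  ext a b
  rw [mul_apply]
  simp only [state, frame, of_apply, mul_diagonal, conjTranspose_apply]
  exact Finset.sum_congr rfl fun i _ => by ring

omit [NormedAddCommGroup E] [NormedSpace ℝ E] in
theorem braket_eq (D : SpectralFamily E d) (θ : E) (A : Matrix (Fin d) (Fin d) ℂ) (j k : Fin d) :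
    braket (D.w θ j) A (D.w θ k) = ((D.frame θ)ᴴ * A * D.frame θ) j k := by
  simp only [braket, frame, of_apply, mul_apply, conjTranspose_apply, Finset.sum_mul]
  exact Finset.sum_comm

namespace IsModelOn

variable {D : SpectralFamily E d} {Θ : Set E} {θ : E}

theorem conjTranspose_frame_mul (hD : D.IsModelOn Θ) (hθ : θ ∈ Θ) :
    (D.frame θ)ᴴ * D.frame θ = 1 := by
  ext i j
  have := orthonormal_iff_ite.1 (hD.orthonormal θ hθ) i j
  rw [PiLp.inner_apply] at this
  rw [one_apply, ← this, mul_apply]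
  refine Finset.sum_congr rfl fun a _ => ?_
  simp [frame, mul_comm]

theorem frame_mul_conjTranspose (hD : D.IsModelOn Θ) (hθ : θ ∈ Θ) :
    D.frame θ * (D.frame θ)ᴴ = 1 :=
  mul_eq_one_comm.1 (hD.conjTranspose_frame_mul hθ)

theorem tangent_eq (hD : D.IsModelOn Θ) (hθ : θ ∈ Θ) (u : E) :
    D.tangent θ u = D.frame θ * diagonal (fun i => (D.dp θ u i : ℂ)) * (D.frame θ)ᴴ +
      D.dframe θ u * diagonal (fun i => (D.p θ i : ℂ)) * (D.frame θ)ᴴ +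
      D.frame θ * diagonal (fun i => (D.p θ i : ℂ)) * (D.dframe θ u)ᴴ := by
  ext a b
  obtain ⟨L, hL, h⟩ := hD.hasFDerivAt_state hθ a b
  rw [tangent, of_apply, hL.fderiv, h, Matrix.add_apply, Matrix.add_apply, mul_apply, mul_apply, mul_apply]
  simp only [mul_diagonal, conjTranspose_apply, frame, dframe, of_apply,
    Finset.sum_add_distrib]

/-- The matrix elements of the tangent vector in the eigenbasis. -/
theorem braket_tangent (hD : D.IsModelOn Θ) (hθ : θ ∈ Θ) (u : E) (j k : Fin d) :
    braket (D.w θ j) (D.tangent θ u) (D.w θ k) =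
      (if j = k then (D.dp θ u j : ℂ) else 0) +
        (D.p θ j - D.p θ k) * inner ℂ (D.dw θ u j) (D.w θ k) := by
  have e1 : (D.frame θ)ᴴ * D.tangent θ u * D.frame θ =
      diagonal (fun i => (D.dp θ u i : ℂ)) +
      ((D.frame θ)ᴴ * D.dframe θ u) * diagonal (fun i => (D.p θ i : ℂ)) +
      diagonal (fun i => (D.p θ i : ℂ)) * ((D.dframe θ u)ᴴ * D.frame θ) := by
    rw [hD.tangent_eq hθ]
    set W := D.frame θ
    have hW : Wᴴ * W = 1 := hD.conjTranspose_frame_mul hθ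
    have hW' : ∀ M, Wᴴ * (W * M) = M := fun M => by
      rw [← Matrix.mul_assoc, hW, Matrix.one_mul]
    simp only [Matrix.mul_add, Matrix.add_mul, Matrix.mul_assoc, hW, hW', Matrix.mul_one]
  have e2 : ((D.frame θ)ᴴ * D.dframe θ u) j k = inner ℂ (D.w θ j) (D.dw θ u k) := by
    rw [mul_apply, PiLp.inner_apply]
    refine Finset.sum_congr rfl fun a _ => ?_
    simp [frame, dframe, mul_comm]
  have e3 : ((D.dframe θ u)ᴴ * D.frame θ) j k = inner ℂ (D.dw θ u j) (D.w θ k) := by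
    rw [mul_apply, PiLp.inner_apply]
    refine Finset.sum_congr rfl fun a _ => ?_
    simp [frame, dframe, mul_comm]
  rw [braket_eq, e1, Matrix.add_apply, Matrix.add_apply, mul_diagonal, diagonal_mul, e2, e3,
    hD.inner_w_dw hθ, diagonal_apply]
  ring

theorem CL_nonneg (hD : D.IsModelOn Θ) (hθ : θ ∈ Θ) (u : E) : 0 ≤ D.CL θ u u := by
  have := hD.p_nonneg θ hθ
  rw [CL_self]
  have h1 := fun i => inv_nonneg.2 (this i)
  have h2 := fun i j => add_nonneg (this i) (this j)
  exact add_nonneg (Finset.sum_nonneg fun i _ => mul_nonneg (h1 i) (sq_nonneg _))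
    (mul_nonneg (by norm_num) (Finset.sum_nonneg fun i _ => Finset.sum_nonneg fun j _ =>
      mul_nonneg (h2 i j) (sq_nonneg _)))

theorem norm_inner_dw_symm (hD : D.IsModelOn Θ) (hθ : θ ∈ Θ) (u : E) (j k : Fin d) :
    ‖(inner ℂ (D.dw θ u j) (D.w θ k) : ℂ)‖ = ‖(inner ℂ (D.dw θ u k) (D.w θ j) : ℂ)‖ := by
  rw [← norm_neg, ← hD.inner_w_dw hθ, norm_inner_symm]

/-- All summands of `C_L` are nonnegative, so each vanishes; this kills every matrix element of the
tangent vector in the eigenbasis. -/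
theorem tangent_eq_zero (hD : D.IsModelOn Θ) (hθ : θ ∈ Θ) {u : E} (h : D.CL θ u u = 0) :
    D.tangent θ u = 0 := by
  have hp := hD.p_nonneg θ hθ
  have h1 := fun i => mul_nonneg (inv_nonneg.2 (hp i)) (sq_nonneg (D.dp θ u i))
  have h2 := fun i j => mul_nonneg (add_nonneg (hp i) (hp j))
    (sq_nonneg ‖(inner ℂ (D.dw θ u i) (D.w θ j) : ℂ)‖)
  have h3 : 0 ≤ ∑ i, (D.p θ i)⁻¹ * D.dp θ u i ^ 2 := Finset.sum_nonneg fun i _ => h1 i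
  have h4 : 0 ≤ ∑ j, ∑ k ∈ Finset.Ioi j,
      (D.p θ j + D.p θ k) * ‖inner ℂ (D.dw θ u j) (D.w θ k)‖ ^ 2 :=
    Finset.sum_nonneg fun i _ => Finset.sum_nonneg fun j _ => h2 i j
  rw [CL_self] at h
  have h5 := (Finset.sum_eq_zero_iff_of_nonneg fun i _ => h1 i).1
    (by linarith : ∑ i, (D.p θ i)⁻¹ * D.dp θ u i ^ 2 = 0)
  have h6 := (Finset.sum_eq_zero_iff_of_nonneg fun i _ =>
    Finset.sum_nonneg fun j _ => h2 i j).1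
    (by linarith : ∑ j, ∑ k ∈ Finset.Ioi j,
      (D.p θ j + D.p θ k) * ‖inner ℂ (D.dw θ u j) (D.w θ k)‖ ^ 2 = 0)
  have hdp : ∀ i, D.dp θ u i = 0 := by
    intro i
    rcases mul_eq_zero.1 (h5 i (Finset.mem_univ i)) with hi | hi
    · exact hD.dp_eq_zero hθ u (inv_eq_zero.1 hi)
    · exact pow_eq_zero_iff two_ne_zero |>.1 hi
  have hlt : ∀ i j, i < j →
      (D.p θ i + D.p θ j) * ‖(inner ℂ (D.dw θ u i) (D.w θ j) : ℂ)‖ ^ 2 = 0 := fun i j hij =>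
    (Finset.sum_eq_zero_iff_of_nonneg fun j _ => h2 i j).1 (h6 i (Finset.mem_univ i)) j
      (Finset.mem_Ioi.2 hij)
  have hne : ∀ i j, i ≠ j →
      (D.p θ i + D.p θ j) * ‖(inner ℂ (D.dw θ u i) (D.w θ j) : ℂ)‖ ^ 2 = 0 := by
    intro i j hij
    rcases lt_or_gt_of_ne hij with hij | hij
    · exact hlt i j hij
    · rw [add_comm, hD.norm_inner_dw_symm hθ]
      exact hlt j i hij
  have hW := hD.frame_mul_conjTranspose hθ
  have hzero : (D.frame θ)ᴴ * D.tangent θ u * D.frame θ = 0 := by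
    ext j k
    rw [← braket_eq, hD.braket_tangent hθ, hdp, Matrix.zero_apply]
    by_cases hjk : j = k
    · simp [hjk]
    · rcases mul_eq_zero.1 (hne j k hjk) with h0 | h0
      -- Here the overlap may be nonzero, but both eigenvalues vanish and so does their difference.
      · have := hp j
        have := hp k
        have e1 : D.p θ j = 0 := by linarith
        have e2 : D.p θ k = 0 := by linarith
        simp [e1, e2]
      · have : (inner ℂ (D.dw θ u j) (D.w θ k) : ℂ) = 0 := by simpa using h0
        simp [this]
  calc D.tangent θ u = (D.frame θ * (D.frame θ)ᴴ) * D.tangent θ u *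
        (D.frame θ * (D.frame θ)ᴴ) := by rw [hW, Matrix.one_mul, Matrix.mul_one]
    _ = D.frame θ * ((D.frame θ)ᴴ * D.tangent θ u * D.frame θ) * (D.frame θ)ᴴ := by
      simp only [Matrix.mul_assoc]
    _ = 0 := by rw [hzero, Matrix.mul_zero, Matrix.zero_mul]

theorem CL_pos (hD : D.IsModelOn Θ) (hθ : θ ∈ Θ) {u : E} (h : D.tangent θ u ≠ 0) :
    0 < D.CL θ u u :=
  (hD.CL_nonneg hθ u).lt_of_ne fun h0 => h (hD.tangent_eq_zero hθ h0.symm)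

theorem CL_eq_morozovaChentsovForm (hD : D.IsModelOn Θ) (hθ : θ ∈ Θ) (hreg : D.IsRegularAt θ)
    (u : E) :
    D.CL θ u u = morozovaChentsovForm 1 cL (D.p θ) (D.w θ) (D.tangent θ u) := by
  have hp := hD.p_nonneg θ hθ
  rw [CL_self, morozovaChentsovForm, one_mul, show (4 : ℝ) = 2 * 2 by norm_num, mul_assoc,
    Finset.mul_sum (a := (2 : ℝ)) (s := Finset.univ)]
  congr 1
  · refine Finset.sum_congr rfl fun i _ => ?_
    simp [hD.braket_tangent hθ]
  · congr 1
    refine Finset.sum_congr rfl fun j _ => ?_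
    rw [Finset.mul_sum]
    refine Finset.sum_congr rfl fun k hk => ?_
    have hjk : j ≠ k := (Finset.mem_Ioi.1 hk).ne
    rw [hD.braket_tangent hθ, if_neg hjk, zero_add, ← Complex.ofReal_sub, norm_mul,
      Complex.norm_real, mul_pow, Real.norm_eq_abs, sq_abs, cL]
    -- For equal eigenvalues `cL` is `0` by division by zero; the term of `C_L` vanishes because
    -- both eigenvalues are zero or, otherwise, by regularity.
    by_cases hpp : D.p θ j = D.p θ k
    · by_cases h0 : D.p θ j = 0
      · simp [← hpp, h0]
      · simp [hreg j k hjk hpp h0 u, hpp]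
    · have := sub_ne_zero.2 hpp
      field_simp

theorem comp (hD : D.IsModelOn Θ) {Θ' : Set F} {φ : F → E} (hΘ' : IsOpen Θ')
    (hφ : DifferentiableOn ℝ φ Θ') (hmaps : Set.MapsTo φ Θ' Θ) : (D.comp φ).IsModelOn Θ' where
  isOpen := hΘ'
  p_nonneg _ hx := hD.p_nonneg _ (hmaps hx)
  p_sum _ hx := hD.p_sum _ (hmaps hx)
  orthonormal _ hx := hD.orthonormal _ (hmaps hx)
  differentiable_p i := (hD.differentiable_p i).comp hφ hmaps
  differentiable_w i := (hD.differentiable_w i).comp hφ hmaps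

theorem CL_comp (hD : D.IsModelOn Θ) {φ : F → E} {x : F} (hφ : DifferentiableAt ℝ φ x)
    (hx : φ x ∈ Θ) (u v : F) :
    (D.comp φ).CL x u v = D.CL (φ x) (fderiv ℝ φ x u) (fderiv ℝ φ x v) := by
  have hp : ∀ u i, (D.comp φ).dp x u i = D.dp (φ x) (fderiv ℝ φ x u) i := fun u i => by
    have := ((hD.hasFDerivAt_p hx i).comp x hφ.hasFDerivAt).fderiv
    exact congrArg (fun f => f u) this
  have hw : ∀ u i, (D.comp φ).dw x u i = D.dw (φ x) (fderiv ℝ φ x u) i := fun u i => by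
    have := ((hD.hasFDerivAt_w hx i).comp x hφ.hasFDerivAt).fderiv
    exact congrArg (fun f => f u) this
  simp only [CL_eq, hp, hw]
  rfl

end IsModelOn

/-- The only danger is `1 / p_i`; constant rank makes it either an honest inverse or identically
`0⁻¹ = 0`. -/
theorem IsSmoothModelOn.contDiffOn_CL {D : SpectralFamily E d} {Θ : Set E}
    (hD : D.IsSmoothModelOn Θ) (u v : E) : ContDiffOn ℝ ∞ (fun θ => D.CL θ u v) Θ := by
  have hdp : ∀ u i, ContDiffOn ℝ ∞ (fun θ => D.dp θ u i) Θ := fun u i =>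
    ((hD.smooth_p i).fderiv_of_isOpen hD.isOpen (m := ∞) (by simp)).clm_apply contDiffOn_const
  have hdw : ∀ u i, ContDiffOn ℝ ∞ (fun θ => D.dw θ u i) Θ := fun u i =>
    ((hD.smooth_w i).fderiv_of_isOpen hD.isOpen (m := ∞) (by simp)).clm_apply contDiffOn_const
  have hinv : ∀ i, ContDiffOn ℝ ∞ (fun θ => (D.p θ i)⁻¹) Θ := fun i => by
    rcases hD.rank_const i with h | h
    · exact (hD.smooth_p i).inv fun θ hθ => (h θ hθ).ne'
    · refine contDiffOn_const (c := (0 : ℝ)) |>.congr fun θ hθ => ?_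
      rw [h θ hθ, _root_.inv_zero]
  simp only [CL_eq]
  refine ContDiffOn.add ?_ (contDiffOn_const.mul ?_)
  · exact ContDiffOn.sum fun i _ => ((hinv i).mul (hdp u i)).mul (hdp v i)
  · refine ContDiffOn.sum fun i _ => ContDiffOn.sum fun j _ => ?_
    refine ((hD.smooth_p i).add (hD.smooth_p j)).mul ?_
    exact Complex.reCLM.contDiff.comp_contDiffOn
      (((hdw u i).inner ℂ (hD.smooth_w j)).mul ((hD.smooth_w j).inner ℂ (hdw v i)))

end SpectralFamily

/-! ### Monotone weighted norms and invariance -/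

namespace IsChannel
open Matrix

variable {n m : ℕ} {Φ : Matrix (Fin n) (Fin n) ℂ →ₗ[ℂ] Matrix (Fin m) (Fin m) ℂ}

/-- `α Tr(Xᴴ ρ X) + β Tr(X ρ Xᴴ)`. -/
def _root_.weightedForm {d : ℕ} (α β : ℝ) (ρ X : Matrix (Fin d) (Fin d) ℂ) : ℝ :=
  α * (Xᴴ * ρ * X).trace.re + β * (X * ρ * Xᴴ).trace.re

theorem weightedForm_le (hΦ : IsChannel Φ) {σ : Matrix (Fin n) (Fin n) ℂ} (hσ : σ.PosSemidef)
    {α β : ℝ} (hα : 0 ≤ α) (hβ : 0 ≤ β)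
    {X : Matrix (Fin m) (Fin m) ℂ} {Y : Matrix (Fin n) (Fin n) ℂ}
    (hXY : ∀ A, (Yᴴ * A).trace = (Xᴴ * Φ A).trace) :
    weightedForm α β σ Y ≤ weightedForm α β (Φ σ) X := by
  -- Channels commute with the adjoint, so `Yᴴ` is dual to `Xᴴ`, and the Schwarz inequality also
  -- covers the `β` term.
  have hXY' : ∀ A, (Yᴴᴴ * A).trace = (Xᴴᴴ * Φ A).trace := by
    intro A
    have := congrArg star (hXY Aᴴ)
    rw [← trace_conjTranspose, ← trace_conjTranspose, hΦ.map_conjTranspose] at this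
    simp only [conjTranspose_mul, conjTranspose_conjTranspose] at this ⊢
    rw [trace_mul_comm Y, trace_mul_comm X, this]
  have h1 := (Complex.le_def.1 (hΦ.schwarz hσ hXY)).1
  have h2 := (Complex.le_def.1 (hΦ.schwarz hσ hXY')).1
  simp only [conjTranspose_conjTranspose] at h2
  exact add_le_add (mul_le_mul_of_nonneg_left h1 hα) (mul_le_mul_of_nonneg_left h2 hβ)

end IsChannel

namespace SpectralFamily

variable {E : Type*} [NormedAddCommGroup E] [NormedSpace ℝ E] {d : ℕ}

/-- The squared length `∑ |A_jk|² / (α p_j + β p_k)` of the tangent vector. -/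
def weightedNorm (D : SpectralFamily E d) (α β : ℝ) (θ u : E) : ℝ :=
  ∑ j, ∑ k, ‖braket (D.w θ j) (D.tangent θ u) (D.w θ k)‖ ^ 2 / (α * D.p θ j + β * D.p θ k)

open Matrix

omit [NormedAddCommGroup E] [NormedSpace ℝ E] in
-- Both traces become diagonal in the eigenbasis: left multiplication by `ρ` weights row `j` by
-- `p_j`, right multiplication weights column `k` by `p_k`.
theorem weightedForm_state (D : SpectralFamily E d) {θ : E} (hW : (D.frame θ)ᴴ * D.frame θ = 1)
    (α β : ℝ) (M : Matrix (Fin d) (Fin d) ℂ) :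
    weightedForm α β (D.state θ) (D.frame θ * M * (D.frame θ)ᴴ) =
      ∑ j, ∑ k, (α * D.p θ j + β * D.p θ k) * ‖M j k‖ ^ 2 := by
  rw [weightedForm, state_eq]
  set W := D.frame θ
  have hW' : ∀ M, Wᴴ * (W * M) = M := fun M => by
    rw [← Matrix.mul_assoc, hW, Matrix.one_mul]
  set P := diagonal fun i => (D.p θ i : ℂ)
  have e1 : ((W * M * Wᴴ)ᴴ * (W * P * Wᴴ) * (W * M * Wᴴ)).trace = (Mᴴ * (P * M)).trace := by
    simp only [conjTranspose_mul, conjTranspose_conjTranspose, Matrix.mul_assoc, hW']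
    rw [trace_mul_comm]
    simp only [Matrix.mul_assoc, hW, Matrix.mul_one]
  have e2 : (W * M * Wᴴ * (W * P * Wᴴ) * (W * M * Wᴴ)ᴴ).trace = (M * P * Mᴴ).trace := by
    simp only [conjTranspose_mul, conjTranspose_conjTranspose, Matrix.mul_assoc, hW']
    rw [trace_mul_comm]
    simp only [Matrix.mul_assoc, hW, Matrix.mul_one]
  have key : ∀ (r : ℝ) (z : ℂ), star z * (r * z) = ((r * ‖z‖ ^ 2 : ℝ) : ℂ) := by
    intro r z
    rw [mul_left_comm, Complex.star_def, Complex.conj_mul']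
    push_cast
    rfl
  have f1 : (Mᴴ * (P * M)).trace = ((∑ j, ∑ k, D.p θ j * ‖M j k‖ ^ 2 : ℝ) : ℂ) := by
    rw [Finset.sum_comm]
    simp only [trace, diag_apply, mul_apply (M := Mᴴ), conjTranspose_apply, P, diagonal_mul, key,
      Complex.ofReal_sum]
  have f2 : (M * P * Mᴴ).trace = ((∑ j, ∑ k, D.p θ k * ‖M j k‖ ^ 2 : ℝ) : ℂ) := by
    simp only [trace, diag_apply, mul_apply (N := Mᴴ), conjTranspose_apply, P, mul_diagonal,
      Complex.ofReal_sum, ← key]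
    exact Finset.sum_congr rfl fun j _ => Finset.sum_congr rfl fun k _ => by ring
  rw [e1, e2, f1, f2, Complex.ofReal_re, Complex.ofReal_re]
  simp only [add_mul, Finset.sum_add_distrib, Finset.mul_sum, mul_assoc]

theorem trace_conjTranspose_mul_tangent (D : SpectralFamily E d) (θ u : E)
    (M : Matrix (Fin d) (Fin d) ℂ) :
    ((D.frame θ * M * (D.frame θ)ᴴ)ᴴ * D.tangent θ u).trace.re =
      ∑ j, ∑ k, (star (M j k) * braket (D.w θ j) (D.tangent θ u) (D.w θ k)).re := by
  have : ((D.frame θ * M * (D.frame θ)ᴴ)ᴴ * D.tangent θ u).trace =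
      (Mᴴ * ((D.frame θ)ᴴ * D.tangent θ u * D.frame θ)).trace := by
    simp only [conjTranspose_mul, conjTranspose_conjTranspose, Matrix.mul_assoc]
    rw [trace_mul_comm]
    simp only [Matrix.mul_assoc]
  rw [this, Finset.sum_comm]
  simp only [trace, diag_apply, mul_apply (M := Mᴴ), conjTranspose_apply, ← braket_eq,
    Complex.re_sum]

namespace IsModelOn

variable {D : SpectralFamily E d} {Θ : Set E} {θ : E}

theorem posSemidef_state (hD : D.IsModelOn Θ) (hθ : θ ∈ Θ) : (D.state θ).PosSemidef := by
  rw [state_eq]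
  refine (posSemidef_diagonal_iff.2 fun i => ?_).mul_mul_conjTranspose_same _
  exact_mod_cast hD.p_nonneg θ hθ i

theorem braket_tangent_eq_zero (hD : D.IsModelOn Θ) (hθ : θ ∈ Θ) (u : E) {j k : Fin d}
    (hj : D.p θ j = 0) (hk : D.p θ k = 0) :
    braket (D.w θ j) (D.tangent θ u) (D.w θ k) = 0 := by
  simp [hD.braket_tangent hθ, hj, hk, hD.dp_eq_zero hθ u hj]

theorem weight_eq_zero (hD : D.IsModelOn Θ) (hθ : θ ∈ Θ) {α β : ℝ} (hα : 0 < α) (hβ : 0 < β)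
    {j k : Fin d} (h : α * D.p θ j + β * D.p θ k = 0) : D.p θ j = 0 ∧ D.p θ k = 0 := by
  have h1 := mul_nonneg hα.le (hD.p_nonneg θ hθ j)
  have h2 := mul_nonneg hβ.le (hD.p_nonneg θ hθ k)
  exact ⟨(mul_eq_zero.1 (by linarith : α * D.p θ j = 0)).resolve_left hα.ne',
    (mul_eq_zero.1 (by linarith : β * D.p θ k = 0)).resolve_left hβ.ne'⟩

/-- `weightedNorm` as an upper bound in its variational formula. -/
theorem le_weightedNorm (hD : D.IsModelOn Θ) (hθ : θ ∈ Θ) {α β : ℝ} (hα : 0 < α) (hβ : 0 < β)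
    (u : E) (X : Matrix (Fin d) (Fin d) ℂ) :
    2 * (Xᴴ * D.tangent θ u).trace.re - weightedForm α β (D.state θ) X ≤
      D.weightedNorm α β θ u := by
  have hW := hD.conjTranspose_frame_mul hθ
  have hX : X = D.frame θ * ((D.frame θ)ᴴ * X * D.frame θ) * (D.frame θ)ᴴ := by
    calc X = (D.frame θ * (D.frame θ)ᴴ) * X * (D.frame θ * (D.frame θ)ᴴ) := by
          rw [hD.frame_mul_conjTranspose hθ, Matrix.one_mul, Matrix.mul_one]
      _ = _ := by simp only [Matrix.mul_assoc]
  rw [hX, trace_conjTranspose_mul_tangent, D.weightedForm_state hW, weightedNorm,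
    Finset.mul_sum, ← Finset.sum_sub_distrib]
  refine Finset.sum_le_sum fun j _ => ?_
  rw [Finset.mul_sum, ← Finset.sum_sub_distrib]
  refine Finset.sum_le_sum fun k _ => ?_
  generalize ((D.frame θ)ᴴ * X * D.frame θ) j k = x
  by_cases h : α * D.p θ j + β * D.p θ k = 0
  · obtain ⟨hj, hk⟩ := hD.weight_eq_zero hθ hα hβ h
    simp [hD.braket_tangent_eq_zero hθ u hj hk, hj, hk]
  · have hpos : 0 < α * D.p θ j + β * D.p θ k :=
      lt_of_le_of_ne (add_nonneg (mul_nonneg hα.le (hD.p_nonneg θ hθ j))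
        (mul_nonneg hβ.le (hD.p_nonneg θ hθ k))) (Ne.symm h)
    generalize braket (D.w θ j) (D.tangent θ u) (D.w θ k) = y
    generalize α * D.p θ j + β * D.p θ k = c at hpos
    have h1 : (star x * y).re ≤ ‖x‖ * ‖y‖ := by
      refine (Complex.re_le_norm _).trans ?_
      rw [norm_mul, norm_star]
    rw [le_div_iff₀ hpos]
    -- Completing the square: `2c‖x‖‖y‖ - c²‖x‖² ≤ ‖y‖²`.
    nlinarith [sq_nonneg (c * ‖x‖ - ‖y‖)]

/-- The maximizer has entries `A_jk / (α p_j + β p_k)` in the eigenbasis, which turns the completed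
square into an equality. -/
theorem exists_weightedNorm_eq (hD : D.IsModelOn Θ) (hθ : θ ∈ Θ) {α β : ℝ} (hα : 0 < α)
    (hβ : 0 < β) (u : E) :
    ∃ X, D.weightedNorm α β θ u =
      2 * (Xᴴ * D.tangent θ u).trace.re - weightedForm α β (D.state θ) X := by
  refine ⟨D.frame θ * (of fun j k => braket (D.w θ j) (D.tangent θ u) (D.w θ k) /
    ((α * D.p θ j + β * D.p θ k : ℝ) : ℂ)) * (D.frame θ)ᴴ, ?_⟩
  rw [trace_conjTranspose_mul_tangent, D.weightedForm_state (hD.conjTranspose_frame_mul hθ),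
    weightedNorm, Finset.mul_sum, ← Finset.sum_sub_distrib]
  refine Finset.sum_congr rfl fun j _ => ?_
  rw [Finset.mul_sum, ← Finset.sum_sub_distrib]
  refine Finset.sum_congr rfl fun k _ => ?_
  rw [of_apply]
  by_cases h : α * D.p θ j + β * D.p θ k = 0
  · obtain ⟨hj, hk⟩ := hD.weight_eq_zero hθ hα hβ h
    simp [hj, hk]
  · generalize braket (D.w θ j) (D.tangent θ u) (D.w θ k) = y
    generalize α * D.p θ j + β * D.p θ k = c at h
    have h1 : star (y / (c : ℂ)) * y = ((‖y‖ ^ 2 / c : ℝ) : ℂ) := by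
      rw [Complex.star_def, map_div₀, Complex.conj_ofReal, div_mul_eq_mul_div, Complex.conj_mul']
      push_cast
      rfl
    rw [h1, Complex.ofReal_re, norm_div, Complex.norm_real, div_pow, Real.norm_eq_abs, sq_abs]
    field_simp
    ring

/-- A fixed linear map commutes with differentiation; expanding it in matrix units reduces this to
entrywise derivatives. -/
theorem tangent_map {m : ℕ} {D' : SpectralFamily E m} (hD : D.IsModelOn Θ) (hθ : θ ∈ Θ)
    {Φ : Matrix (Fin d) (Fin d) ℂ →ₗ[ℂ] Matrix (Fin m) (Fin m) ℂ}
    (h : ∀ t ∈ Θ, D'.state t = Φ (D.state t)) (u : E) :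
    D'.tangent θ u = Φ (D.tangent θ u) := by
  have hΦ : ∀ A a b, Φ A a b = ∑ i, ∑ j, Φ (single i j 1) a b * A i j := by
    intro A a b
    conv_lhs => rw [matrix_eq_sum_single A]
    simp only [map_sum, Matrix.sum_apply]
    refine Finset.sum_congr rfl fun i _ => Finset.sum_congr rfl fun j _ => ?_
    have : single i j (A i j) = A i j • single i j (1 : ℂ) := by simp [smul_single]
    rw [this, map_smul, Matrix.smul_apply, smul_eq_mul, mul_comm]
  ext a b
  choose L hL _ using hD.hasFDerivAt_state hθ
  have h1 : HasFDerivAt (fun t => Φ (D.state t) a b)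
      (∑ i, ∑ j, Φ (single i j 1) a b • L i j) θ := by
    simp only [hΦ (D.state _)]
    exact HasFDerivAt.fun_sum fun i _ => HasFDerivAt.fun_sum fun j _ => (hL i j).const_mul _
  have h2 : (fun t => D'.state t a b) =ᶠ[nhds θ] fun t => Φ (D.state t) a b := by
    filter_upwards [hD.isOpen.mem_nhds hθ] with t ht
    rw [h t ht]
  rw [tangent, of_apply, h2.fderiv_eq, h1.fderiv, hΦ]
  simp [tangent, (hL _ _).fderiv]

/-- Monotonicity of `weightedNorm` under channels. -/
theorem weightedNorm_le {m : ℕ} {D' : SpectralFamily E m} (hD : D.IsModelOn Θ)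
    (hD' : D'.IsModelOn Θ) (hθ : θ ∈ Θ)
    {Φ : Matrix (Fin d) (Fin d) ℂ →ₗ[ℂ] Matrix (Fin m) (Fin m) ℂ} (hΦ : IsChannel Φ)
    (h : ∀ t ∈ Θ, D'.state t = Φ (D.state t)) {α β : ℝ} (hα : 0 < α) (hβ : 0 < β) (u : E) :
    D'.weightedNorm α β θ u ≤ D.weightedNorm α β θ u := by
  obtain ⟨X, hX⟩ := hD'.exists_weightedNorm_eq hθ hα hβ u
  obtain ⟨Y, hY⟩ := IsChannel.exists_adjoint X Φ
  rw [hX, hD.tangent_map hθ h, ← hY, h θ hθ]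
  have h1 := hΦ.weightedForm_le (hD.posSemidef_state hθ) hα.le hβ.le hY
  have h2 := hD.le_weightedNorm hθ hα hβ u Y
  linarith

/-- The weights are chosen so that `(t + 1) p_j + (t - 1) p_k = (p_j + p_k)(t + z_jk)`, a simple
pole in `t` at `-z_jk`. -/
theorem weightedNorm_eq (hD : D.IsModelOn Θ) (hθ : θ ∈ Θ) (u : E) (t : ℝ) :
    D.weightedNorm (t + 1) (t - 1) θ u =
      ∑ x : Fin d × Fin d, ‖braket (D.w θ x.1) (D.tangent θ u) (D.w θ x.2)‖ ^ 2 /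
        (D.p θ x.1 + D.p θ x.2) / (t + (D.p θ x.1 - D.p θ x.2) / (D.p θ x.1 + D.p θ x.2)) := by
  rw [weightedNorm, Fintype.sum_prod_type]
  refine Finset.sum_congr rfl fun j _ => Finset.sum_congr rfl fun k _ => ?_
  by_cases h : D.p θ j + D.p θ k = 0
  · have := hD.p_nonneg θ hθ j
    have := hD.p_nonneg θ hθ k
    rw [hD.braket_tangent_eq_zero hθ u (by linarith : D.p θ j = 0) (by linarith : D.p θ k = 0)]
    simp
  · rw [div_div, mul_add, mul_div_cancel₀ _ h]
    congr 1
    ring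

/-- `c_L(x, y) (x + y)`, and on the diagonal `(x + x) / x`, in terms of
`z = (x - y) / (x + y)`. -/
def _root_.ratioWeight (z : ℝ) : ℝ := if z = 0 then 2 else 2 / z ^ 2

/-- The value `2` of `ratioWeight` at `0` serves the diagonal, where `|A_jj|² / (2 p_j)` must become
`|A_jj|² / p_j`. Off-diagonal pairs with `z = 0` contribute nothing to the right side, and
regularity removes them from `C_L` too. -/
theorem CL_eq_sum (hD : D.IsModelOn Θ) (hθ : θ ∈ Θ) (hreg : D.IsRegularAt θ) (u : E) :
    D.CL θ u u = ∑ x : Fin d × Fin d,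
      ‖braket (D.w θ x.1) (D.tangent θ u) (D.w θ x.2)‖ ^ 2 / (D.p θ x.1 + D.p θ x.2) *
        ratioWeight ((D.p θ x.1 - D.p θ x.2) / (D.p θ x.1 + D.p θ x.2)) := by
  -- Passes from all ordered pairs to the diagonal plus twice the pairs `j < k`.
  have hsum : ∀ f : Fin d → Fin d → ℝ, (∀ j k, f j k = f k j) →
      ∑ j, ∑ k, f j k = ∑ j, f j j + 2 * ∑ j, ∑ k ∈ Finset.Ioi j, f j k := by
    intro f hf
    have h1 : ∀ j, ∑ k, f j k =
        f j j + (∑ k ∈ Finset.Ioi j, f j k + ∑ k ∈ Finset.Iio j, f j k) := by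
      intro j
      rw [← Finset.add_sum_erase _ _ (Finset.mem_univ j), ← Finset.sum_union]
      · congr 1
        refine Finset.sum_congr ?_ fun _ _ => rfl
        ext k
        simp only [Finset.mem_erase, Finset.mem_univ, and_true, Finset.mem_union, Finset.mem_Ioi,
          Finset.mem_Iio]
        exact ne_iff_gt_or_lt
      · exact Finset.disjoint_left.2 fun k h1 h2 =>
          lt_asymm (Finset.mem_Ioi.1 h1) (Finset.mem_Iio.1 h2)
    have h2 : ∑ j, ∑ k ∈ Finset.Iio j, f j k = ∑ j, ∑ k ∈ Finset.Ioi j, f j k := by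
      rw [Finset.sum_comm' (t' := Finset.univ) (s' := fun k => Finset.Ioi k) (by simp)]
      simp only [hf]
    simp only [h1, Finset.sum_add_distrib, h2]
    ring
  rw [Fintype.sum_prod_type, hsum, CL_self, show (4 : ℝ) = 2 * 2 by norm_num, mul_assoc,
    Finset.mul_sum (a := (2 : ℝ)) (s := Finset.univ)]
  · congr 1
    · refine Finset.sum_congr rfl fun j _ => ?_
      simp only [hD.braket_tangent hθ, sub_self, zero_div, ratioWeight, if_true]
      by_cases h : D.p θ j = 0
      · simp [h]
      · simp
        field_simp
        ring
    · congr 1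
      refine Finset.sum_congr rfl fun j _ => ?_
      rw [Finset.mul_sum]
      refine Finset.sum_congr rfl fun k hk => ?_
      have hjk : j ≠ k := (Finset.mem_Ioi.1 hk).ne
      simp only [hD.braket_tangent hθ, if_neg hjk, zero_add, ratioWeight]
      rw [← Complex.ofReal_sub, norm_mul, Complex.norm_real, mul_pow, Real.norm_eq_abs, sq_abs]
      by_cases hpp : D.p θ j = D.p θ k
      · by_cases h0 : D.p θ j = 0
        · simp [← hpp, h0]
        · simp [hreg j k hjk hpp h0 u, hpp]
      · have h1 := sub_ne_zero.2 hpp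
        have h2 : D.p θ j + D.p θ k ≠ 0 := by
          intro h
          have := hD.p_nonneg θ hθ j
          have := hD.p_nonneg θ hθ k
          exact hpp (by linarith)
        rw [if_neg (div_ne_zero h1 h2)]
        field_simp
  · intro j k
    have hn : ‖braket (D.w θ j) (D.tangent θ u) (D.w θ k)‖ =
        ‖braket (D.w θ k) (D.tangent θ u) (D.w θ j)‖ := by
      by_cases hjk : j = k
      · rw [hjk]
      · rw [hD.braket_tangent hθ, hD.braket_tangent hθ, if_neg hjk, if_neg (Ne.symm hjk), zero_add,
          zero_add, norm_mul, norm_mul, hD.norm_inner_dw_symm hθ, norm_sub_rev]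
    have hs : (D.p θ k - D.p θ j) / (D.p θ k + D.p θ j) =
        -((D.p θ j - D.p θ k) / (D.p θ j + D.p θ k)) := by
      rw [← neg_div, neg_sub, add_comm]
    simp only [ratioWeight, hs, hn, neg_eq_zero, neg_sq]
    rw [add_comm]

theorem neg_one_le_ratio (hD : D.IsModelOn Θ) (hθ : θ ∈ Θ) (j k : Fin d) :
    -1 ≤ (D.p θ j - D.p θ k) / (D.p θ j + D.p θ k) := by
  have h1 := hD.p_nonneg θ hθ j
  have h2 := hD.p_nonneg θ hθ k
  rcases (add_nonneg h1 h2).eq_or_lt with h | h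
  · rw [← h, div_zero]
    norm_num
  · rw [le_div_iff₀ h]
    linarith

end IsModelOn

theorem isInvariantWhere_CL :
    IsInvariantWhere (E := E) SpectralFamily.IsRegularAt SpectralFamily.CL := by
  rintro n m Θ D D' hD hD' ⟨Φ, Ψ, hΦ, hΨ, h⟩ θ hθ hr hr' u v
  have key : ∀ u, D.CL θ u u = D'.CL θ u u := by
    intro u
    rw [hD.CL_eq_sum hθ hr, hD'.CL_eq_sum hθ hr']
    -- Channels in both directions turn monotonicity into equality; `t > 1` keeps both weights
    -- positive.
    have hle : ∀ t : ℝ, 1 < t →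
        D.weightedNorm (t + 1) (t - 1) θ u = D'.weightedNorm (t + 1) (t - 1) θ u := by
      intro t ht
      have h1 : 0 < t + 1 := by linarith
      have h2 : 0 < t - 1 := by linarith
      exact le_antisymm (hD'.weightedNorm_le hD hθ hΦ (fun t ht => (h t ht).1) h1 h2 u)
        (hD.weightedNorm_le hD' hθ hΨ (fun t ht => (h t ht).2) h1 h2 u)
    simp only [hD.weightedNorm_eq hθ, hD'.weightedNorm_eq hθ] at hle
    exact sum_mul_eq_of_sum_div_linear_eq _ _ _ _
      (fun x : Fin n × Fin n => hD.neg_one_le_ratio hθ x.1 x.2)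
      (fun x : Fin m × Fin m => hD'.neg_one_le_ratio hθ x.1 x.2) hle ratioWeight
  beta_reduce
  rw [CL_polarization, key, key, key, ← CL_polarization]

end SpectralFamily

/-! ### The functions `cL` and `fCL`, and the depolarizing channel -/

theorem isChannel_id (d : ℕ) :
    IsChannel (LinearMap.id : Matrix (Fin d) (Fin d) ℂ →ₗ[ℂ] Matrix (Fin d) (Fin d) ℂ) where
  trace_preserving _ := rfl
  completely_positive _ _ hB := hB

theorem cL_comm (x y : ℝ) : cL x y = cL y x := by
  rw [cL, cL, add_comm, ← neg_sub y x, neg_sq]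

theorem cL_mul_mul {α : ℝ} (x y : ℝ) (hα : 0 < α) : cL (α * x) (α * y) = α⁻¹ * cL x y := by
  rw [cL, cL, ← mul_add, ← mul_sub, mul_pow, sq α, mul_assoc α α, mul_div_mul_left _ _ hα.ne',
    div_mul_eq_div_div_swap, mul_left_comm, div_eq_inv_mul _ α]

theorem one_div_cL_one {t : ℝ} : 1 / cL t 1 = fCL t := by
  rw [cL, fCL, one_div, mul_inv, inv_div, add_comm 1 t, mul_comm, ← div_eq_mul_inv, div_div,
    mul_comm 2]

theorem fCL_eq_mul_fCL_inv {t : ℝ} (ht : 0 < t) : fCL t = t * fCL t⁻¹ := by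
  have : (1 + t) ≠ 0 := by positivity
  have : (t + 1) ≠ 0 := by positivity
  rw [fCL, fCL]
  field_simp
  ring

theorem not_monotoneOn_fCL : ¬ MonotoneOn fCL (Set.Ioi 0) := by
  intro h
  have := h (show (1 / 2 : ℝ) ∈ Set.Ioi 0 by norm_num) (show (1 : ℝ) ∈ Set.Ioi 0 by norm_num)
    (by norm_num)
  norm_num [fCL] at this

open Matrix in
theorem isChannel_depolarizing {d : ℕ} (hd : d ≠ 0) {ε : ℝ} (h0 : 0 ≤ ε) (h1 : ε ≤ 1) :
    IsChannel (depolarizing d ε) where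
  trace_preserving A := by
    have : (d : ℂ) ≠ 0 := Nat.cast_ne_zero.2 hd
    simp [depolarizing, trace_add, trace_smul]
    field_simp
    ring
  completely_positive k B hB := by
    -- The partial trace of `B`; the ampliation is `(1 - ε) B` plus `ε/d` times this matrix tensored
    -- with the identity.
    have hT : (∑ i : Fin d, B.submatrix (fun x : Fin k => (x, i)) fun x => (x, i)).PosSemidef :=
      posSemidef_sum _ fun i _ => hB.submatrix _
    have h := (hB.smul (a := ((1 - ε : ℝ) : ℂ)) (by exact_mod_cast sub_nonneg.2 h1)).add
      ((hT.kronecker (PosSemidef.one (n := Fin d) (R := ℂ))).smul (a := ((ε / d : ℝ) : ℂ))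
        (by exact_mod_cast div_nonneg h0 d.cast_nonneg))
    convert h using 1
    ext ⟨x, i⟩ ⟨y, j⟩
    simp [ampliation, depolarizing, trace, Matrix.sum_apply]

/-! ### The rotating family and failure of monotonicity -/

theorem orthonormal_rotatingFrame (θ : ℝ) : Orthonormal ℂ (rotatingFrame θ) := by
  have h : ((Real.cos θ : ℂ)) * Real.cos θ + Real.sin θ * Real.sin θ = 1 := by
    have := Real.cos_sq_add_sin_sq θ
    rw [sq, sq] at this
    exact_mod_cast this
  have h' : ((Real.sin θ : ℂ)) * Real.sin θ + Real.cos θ * Real.cos θ = 1 := by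
    rw [add_comm, h]
  rw [orthonormal_iff_ite]
  intro i j
  fin_cases i <;> fin_cases j <;>
    simp [rotatingFrame, PiLp.inner_apply, Fin.sum_univ_three, -Complex.ofReal_cos,
      -Complex.ofReal_sin, -inner_self_eq_norm_sq_to_K, h, h', mul_comm]

theorem hasDerivAt_rotatingFrame (θ : ℝ) (i : Fin 3) :
    HasDerivAt (fun t => rotatingFrame t i)
      ((![0, rotatingFrame θ 2, -rotatingFrame θ 1] : Fin 3 → EuclideanSpace ℂ (Fin 3)) i) θ := by
  have hc := (Real.hasDerivAt_cos θ).ofReal_comp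
  have hs := (Real.hasDerivAt_sin θ).ofReal_comp
  rw [hasDerivAt_iff_hasFDerivAt, ← hasFDerivWithinAt_univ, hasFDerivWithinAt_piLp]
  intro a
  rw [hasFDerivWithinAt_univ, hasFDerivAt_iff_hasDerivAt]
  fin_cases i <;> fin_cases a <;>
    simp [rotatingFrame, -Complex.ofReal_cos, -Complex.ofReal_sin, hasDerivAt_const] 
  · simpa [-Complex.ofReal_cos, -Complex.ofReal_sin] using hc
  · exact hs
  · simpa [-Complex.ofReal_cos, -Complex.ofReal_sin] using hs.fun_neg
  · simpa [-Complex.ofReal_cos, -Complex.ofReal_sin] using hc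

/-- The family with constant eigenvalues `q` and eigenvectors `rotatingFrame θ`. -/
def rotatingFamily (q : Fin 3 → ℝ) : SpectralFamily ℝ 3 where
  p _ := q
  w := rotatingFrame

theorem isModelOn_rotatingFamily {q : Fin 3 → ℝ} (h0 : ∀ i, 0 ≤ q i) (h1 : ∑ i, q i = 1) :
    (rotatingFamily q).IsModelOn Set.univ where
  isOpen := isOpen_univ
  p_nonneg _ _ := h0
  p_sum _ _ := h1
  orthonormal θ _ := orthonormal_rotatingFrame θ
  differentiable_p _ := differentiableOn_const _
  differentiable_w i θ _ := (hasDerivAt_rotatingFrame θ i).differentiableAt.differentiableWithinAt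

/-- The eigenvalues are constant and the last two eigenvectors rotate into each other at unit speed,
so a single pair contributes. -/
theorem CL_rotatingFamily (q : Fin 3 → ℝ) (θ : ℝ) :
    (rotatingFamily q).CL θ 1 1 = 4 * (q 1 + q 2) := by
  have hp : ∀ i, (rotatingFamily q).dp θ 1 i = 0 := by
    intro i
    simp [SpectralFamily.dp, rotatingFamily]
  have hw : ∀ i, (rotatingFamily q).dw θ 1 i =
      (![0, rotatingFrame θ 2, -rotatingFrame θ 1] : Fin 3 → EuclideanSpace ℂ (Fin 3)) i :=
    fun i => (hasDerivAt_rotatingFrame θ i).deriv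
  have ho := orthonormal_iff_ite.1 (orthonormal_rotatingFrame θ)
  have hw' : (rotatingFamily q).w θ = rotatingFrame θ := rfl
  have hq : (rotatingFamily q).p θ = q := rfl
  have i0 : (Finset.Ioi (0 : Fin 3)) = {1, 2} := by decide
  have i1 : (Finset.Ioi (1 : Fin 3)) = {2} := by decide
  have i2 : (Finset.Ioi (2 : Fin 3)) = ∅ := by decide
  simp [SpectralFamily.CL, SpectralFamily.CUpsilon, hp, hw, hw', hq, Fin.sum_univ_three, i0, i1,
    i2, ho]

theorem state_rotatingFamily_depolarizing (q : Fin 3 → ℝ) (hq : ∑ i, q i = 1) (ε θ : ℝ) :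
    (rotatingFamily fun i => (1 - ε) * q i + ε / 3).state θ =
      depolarizing 3 ε ((rotatingFamily q).state θ) := by
  have h : ((Real.cos θ : ℂ)) ^ 2 + Real.sin θ ^ 2 = 1 := by
    exact_mod_cast Real.cos_sq_add_sin_sq θ
  have hq' : (q 0 : ℂ) + q 1 + q 2 = 1 := by
    rw [Fin.sum_univ_three] at hq
    exact_mod_cast hq
  have htr : ((rotatingFamily q).state θ).trace = 1 := by
    simp [rotatingFamily, SpectralFamily.state, Matrix.trace, Fin.sum_univ_three, rotatingFrame,
      -Complex.ofReal_cos, -Complex.ofReal_sin]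
    linear_combination hq' + (q 1 + q 2 : ℂ) * h
  ext a b
  simp [depolarizing, htr]
  fin_cases a <;> fin_cases b <;>
    simp [rotatingFamily, SpectralFamily.state, Fin.sum_univ_three, rotatingFrame,
      -Complex.ofReal_cos, -Complex.ofReal_sin]
  · linear_combination (ε / 3 : ℂ) * h
  · ring
  · ring
  · linear_combination (ε / 3 : ℂ) * h

theorem inputFamily_eq (δ η : ℝ) :
    inputFamily δ η = rotatingFamily ![1 - 2 * δ, δ + η, δ - η] := rfl

theorem outputFamily_eq (δ η ε : ℝ) :
    outputFamily δ η ε =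
      rotatingFamily fun i => (1 - ε) * (![1 - 2 * δ, δ + η, δ - η] : Fin 3 → ℝ) i + ε / 3 := by
  rw [outputFamily, rotatingFamily]
  congr
  funext _ i
  fin_cases i <;> rfl

theorem isModelOn_inputFamily {δ η : ℝ} (h1 : δ ≤ 1 / 2) (h2 : |η| ≤ δ) :
    (inputFamily δ η).IsModelOn Set.univ := by
  have := abs_le.1 h2
  rw [inputFamily_eq]
  refine isModelOn_rotatingFamily (fun i => ?_) ?_
  · fin_cases i <;> simp <;> linarith
  · simp [Fin.sum_univ_three]
    ring

theorem isModelOn_outputFamily {δ η ε : ℝ} (h1 : δ ≤ 1 / 2) (h2 : |η| ≤ δ) (h3 : 0 ≤ ε)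
    (h4 : ε ≤ 1) : (outputFamily δ η ε).IsModelOn Set.univ := by
  have hin := isModelOn_inputFamily h1 h2
  rw [outputFamily_eq]
  refine isModelOn_rotatingFamily (fun i => ?_) ?_
  · exact add_nonneg (mul_nonneg (by linarith) (hin.p_nonneg 0 trivial i)) (by linarith)
  · simp [Fin.sum_univ_three]
    ring

theorem state_outputFamily (δ η ε θ : ℝ) :
    (outputFamily δ η ε).state θ = depolarizing 3 ε ((inputFamily δ η).state θ) := by
  rw [outputFamily_eq, inputFamily_eq, state_rotatingFamily_depolarizing]
  simp [Fin.sum_univ_three]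
  ring

theorem CL_inputFamily (δ η θ : ℝ) : (inputFamily δ η).CL θ 1 1 = 8 * δ := by
  rw [inputFamily_eq, CL_rotatingFamily]
  simp
  ring

theorem CL_outputFamily (δ η ε θ : ℝ) :
    (outputFamily δ η ε).CL θ 1 1 = 8 * δ + 8 * ε * (1 / 3 - δ) := by
  rw [outputFamily_eq, CL_rotatingFamily]
  simp
  ring

theorem not_isMonotoneWhere_CL :
    ¬ IsMonotoneWhere (E := ℝ) SpectralFamily.IsSimpleAt SpectralFamily.CL := by
  intro h
  have hη : |(1 / 8 : ℝ)| ≤ 1 / 4 := by rw [abs_of_nonneg] <;> norm_num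
  -- The spectrum `1/2, 3/8, 1/8` is sent to `5/12, 17/48, 11/48`; both are simple, and `C_L` rises
  -- from `2` to `7/3`.
  have := h 3 3 Set.univ (inputFamily (1 / 4) (1 / 8)) (outputFamily (1 / 4) (1 / 8) (1 / 2))
    (depolarizing 3 (1 / 2)) (isModelOn_inputFamily (by norm_num) hη)
    (isModelOn_outputFamily (by norm_num) hη (by norm_num) (by norm_num))
    (isChannel_depolarizing (by norm_num) (by norm_num) (by norm_num))
    (fun θ _ => state_outputFamily _ _ _ θ) 0 trivial
    ⟨fun i => by fin_cases i <;> norm_num [inputFamily], fun i j hij => by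
      fin_cases i <;> fin_cases j <;> first | rfl | norm_num [inputFamily] at hij⟩
    ⟨fun i => by fin_cases i <;> norm_num [outputFamily], fun i j hij => by
      fin_cases i <;> fin_cases j <;> first | rfl | norm_num [outputFamily] at hij⟩ 1
  beta_reduce at this
  rw [CL_inputFamily, CL_outputFamily] at this
  norm_num at this

end

theorem mainTheorem10
    {E F : Type*} [NormedAddCommGroup E] [NormedSpace ℝ E]
    [NormedAddCommGroup F] [NormedSpace ℝ F] :
    -- `C_L` in terms of the derivatives of the eigenvalues and eigenvectors
    (∀ (d : ℕ) (D : SpectralFamily E d) (θ u : E),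
      D.CL θ u u = ∑ i, (D.p θ i)⁻¹ * D.dp θ u i ^ 2
        + 4 * ∑ j, ∑ k ∈ Finset.Ioi j,
            (D.p θ j + D.p θ k) * ‖inner ℂ (D.dw θ u j) (D.w θ k)‖ ^ 2) ∧
    -- `C_L` is a Riemannian metric: a symmetric, positive semidefinite bilinear form at each
    -- point, positive on every direction in which the state changes, smooth, and
    -- transforming correctly under changes of coordinates
    (∀ (d : ℕ) (Θ : Set E) (D : SpectralFamily E d), D.IsModelOn Θ → ∀ θ ∈ Θ,
      (∀ u v, D.CL θ u v = D.CL θ v u) ∧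
      (∀ (a : ℝ) (u v v' : E), D.CL θ u (a • v + v') = a * D.CL θ u v + D.CL θ u v') ∧
      (∀ u, 0 ≤ D.CL θ u u) ∧
      (∀ u, D.tangent θ u ≠ 0 → 0 < D.CL θ u u)) ∧
    (∀ (d : ℕ) (Θ : Set E) (D : SpectralFamily E d), D.IsSmoothModelOn Θ →
      ∀ u v, ContDiffOn ℝ ∞ (fun θ => D.CL θ u v) Θ) ∧
    (∀ (d : ℕ) (Θ : Set E) (D : SpectralFamily E d) (Θ' : Set F) (φ : F → E),
      D.IsModelOn Θ → IsOpen Θ' → DifferentiableOn ℝ φ Θ' → Set.MapsTo φ Θ' Θ →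
        (D.comp φ).IsModelOn Θ' ∧
        ∀ x ∈ Θ', ∀ u v,
          (D.comp φ).CL x u v = D.CL (φ x) (fderiv ℝ φ x u) (fderiv ℝ φ x v)) ∧
    -- it has the Morozova–Chentsov form with `C = 1` and the function `cL`
    (∀ (d : ℕ) (Θ : Set E) (D : SpectralFamily E d), D.IsModelOn Θ → ∀ θ ∈ Θ,
      D.IsRegularAt θ → ∀ u,
        D.CL θ u u = morozovaChentsovForm 1 cL (D.p θ) (D.w θ) (D.tangent θ u)) ∧
    (∀ x y, cL x y = cL y x) ∧
    (∀ α x y, 0 < α → cL (α * x) (α * y) = α⁻¹ * cL x y) ∧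
    -- it depends only on the family of states, and it is invariant
    (∀ (d : ℕ) (Θ : Set E) (D D' : SpectralFamily E d), D.IsModelOn Θ → D'.IsModelOn Θ →
      (∀ θ ∈ Θ, D.state θ = D'.state θ) →
        ∀ θ ∈ Θ, D.IsRegularAt θ → D'.IsRegularAt θ → ∀ u v, D.CL θ u v = D'.CL θ u v) ∧
    IsInvariantWhere (E := E) SpectralFamily.IsRegularAt SpectralFamily.CL ∧
    -- its associated function `f(t) = 1 / c(t, 1)` is not monotone
    (∀ t, 0 ≤ t → t ≠ 1 → 1 / cL t 1 = fCL t) ∧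
    (∀ t, 0 < t → fCL t = t * fCL t⁻¹) ∧
    fCL 1 < fCL 0 ∧
    ¬ MonotoneOn fCL (Set.Ici 0) ∧
    ¬ MonotoneOn fCL (Set.Ioi 0) ∧
    -- it is not monotone, even on one-parameter families of full-rank states with
    -- pairwise distinct eigenvalues
    ¬ IsMonotoneWhere (E := ℝ) SpectralFamily.IsSimpleAt SpectralFamily.CL ∧
    -- explicitly, the three-dimensional depolarizing channel increases it
    (∀ δ η ε : ℝ, 0 ≤ δ → δ ≤ 1 / 2 → |η| ≤ δ → 0 ≤ ε → ε ≤ 1 →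
      IsChannel (depolarizing 3 ε) ∧
      (inputFamily δ η).IsModelOn Set.univ ∧
      (outputFamily δ η ε).IsModelOn Set.univ ∧
      ∀ θ : ℝ,
        (outputFamily δ η ε).state θ = depolarizing 3 ε ((inputFamily δ η).state θ) ∧
        (inputFamily δ η).CL θ 1 1 = 8 * δ ∧
        (outputFamily δ η ε).CL θ 1 1 = 8 * δ + 8 * ε * (1 / 3 - δ) ∧
        (outputFamily δ η ε).CL θ 1 1 - (inputFamily δ η).CL θ 1 1 = 8 * ε * (1 / 3 - δ) ∧
        (0 < ε → δ < 1 / 3 →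
          (inputFamily δ η).CL θ 1 1 < (outputFamily δ η ε).CL θ 1 1)) := by
  refine ⟨fun _ D θ u => D.CL_self θ u, fun _ _ D hD θ hθ => ⟨D.CL_symm θ, D.CL_smul_add θ,
    hD.CL_nonneg hθ, fun _ => hD.CL_pos hθ⟩, fun _ _ _ hD => hD.contDiffOn_CL,
    fun _ _ _ _ _ hD hΘ' hφ hmaps => ⟨hD.comp hΘ' hφ hmaps, fun x hx =>
      hD.CL_comp (hφ.differentiableAt (hΘ'.mem_nhds hx)) (hmaps hx)⟩,
    fun _ _ _ hD _ hθ hreg => hD.CL_eq_morozovaChentsovForm hθ hreg, cL_comm,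
    fun _ x y hα => cL_mul_mul x y hα, fun d Θ D D' hD hD' h =>
      SpectralFamily.isInvariantWhere_CL d d Θ D D' hD hD' ⟨LinearMap.id, LinearMap.id,
        isChannel_id d, isChannel_id d, fun θ hθ => ⟨h θ hθ, (h θ hθ).symm⟩⟩,
    SpectralFamily.isInvariantWhere_CL, fun _ _ _ => one_div_cL_one,
    fun _ => fCL_eq_mul_fCL_inv, by norm_num [fCL],
    fun h => not_monotoneOn_fCL (h.mono Set.Ioi_subset_Ici_self), not_monotoneOn_fCL,
    not_isMonotoneWhere_CL, fun δ η ε _ hδ hη h0 h1 =>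
      ⟨isChannel_depolarizing (by norm_num) h0 h1, isModelOn_inputFamily hδ hη,
        isModelOn_outputFamily hδ hη h0 h1, fun θ => ⟨state_outputFamily δ η ε θ,
          CL_inputFamily δ η θ, CL_outputFamily δ η ε θ, ?_, fun hε hδ' => ?_⟩⟩⟩
  · rw [CL_inputFamily, CL_outputFamily, add_sub_cancel_left]
  · rw [CL_inputFamily, CL_outputFamily]
    exact lt_add_of_pos_right _ (mul_pos (by linarith) (by linarith))
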